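/- For $n\ge 1$ and $j\in\{0,1\}^n$ let $h(j)$ be the number of ones of $j$, let $|j\rangle$ be the corresponding computational basis state of $n$ qubits and $|j_+\rangle$ the state obtained from $|j\rangle$ by a Hadamard gate on every qubit. Put $$H_0^n=\sum_j h(j)\,|j_+\rangle\langle j_+|,\qquad H_1^n=\sum_j h(j)\,|j\rangle\langle j|,\qquad \theta_h=\frac n2+\sqrt{40\,n\log n},$$ where $\log$ is the natural logarithm. The unique ground states of $H_0^n$ and $H_1^n$ are $|{+}\cdots{+}\rangle$ and $|0\cdots 0\rangle$. Let $\varepsilon(n)=o(n^5)$. For each $n$ let $\widetilde H_0^n$ (respectively $\widetilde H_1^n$) be equal to $H_0^n$ (respectively $H_1^n$), except that the energies (eigenvalues) of the states $|j_+\rangle$ (respectively $|j\rangle$) with $h(j)>\theta_h$ are changed by arbitrary real amounts of absolute value at most $\varepsilon(n)$. Let $\widetilde H^n_s=(1-s)\widetilde H^n_0+s\widetilde H^n_1$ and let $\psi$ be the evolution of $\psi(0)=|{+}\cdots{+}\rangle$ by the Schrödinger equation $i\,\psi'(t)=\widetilde H^n_{t/\tau}\,\psi(t)$, $0\le t\le\tau$,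 with $\tau=n^4$. Then $\psi(\tau)$ is, up to a global phase, within distance $o(1)$ of $|0\cdots0\rangle$ as $n\to\infty$: $$\min_{|\gamma|=1}\bigl\|\psi(n^4)-\gamma\,|0\cdots0\rangle\bigr\|\le\eta(n),\qquad \eta(n)\to 0,$$ where $\eta$ depends only on the function $\varepsilon$. No assumption is made on the spectral gap of $\widetilde H^n_s$ or on the ordering of the energies of $\widetilde H^n_0$ and $\widetilde H^n_1$: the perturbation may make the gap arbitrarily small or zero, and $|{+}\cdots{+}\rangle$, $|0\cdots0\rangle$ need not be ground states of $\widetilde H^n_0$, $\widetilde H^n_1$. -/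

import Mathlib

open Filter Topology Asymptotics

noncomputable section

namespace AdiabaticRobustness

/-- Bit strings of length `n`; they stand for the integers `0, …, 2 ^ n - 1` through their binary
expansions, with `0` the all-zero string. -/
abbrev Bits (n : ℕ) : Type := Fin n → Fin 2

/-- The Hilbert space of `n` qubits, coordinates being taken in the computational basis. -/
abbrev Qubits (n : ℕ) : Type := EuclideanSpace ℂ (Bits n)

/-- The Hamming weight `h(j)`, the number of ones of `j`. -/
def hammingWeight {n : ℕ} (j : Bits n) : ℕ :=
  (Finset.univ.filter fun k : Fin n => j k = 1).card

/-- The Hadamard gate on one qubit. -/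
def hadamard : Matrix (Fin 2) (Fin 2) ℂ :=
  ((1 / Real.sqrt 2 : ℝ) : ℂ) • !![1, 1; 1, -1]

/-- The computational basis state `|j⟩`. -/
def ket {n : ℕ} (j : Bits n) : Qubits n :=
  EuclideanSpace.single j 1

/-- The state `|j₊⟩`, i.e. `|j⟩` after a Hadamard gate on every qubit: its amplitude on `|x⟩`
is `∏ k, ⟨x k| Had |j k⟩`. -/
def ketPlus {n : ℕ} (j : Bits n) : Qubits n :=
  WithLp.toLp 2 fun x => ∏ k, hadamard (x k) (j k)

/-- The operator `∑ j, E j |b j⟩⟨b j|`. -/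
def spectralSum {n : ℕ} (b : Bits n → Qubits n) (E : Bits n → ℝ) : Qubits n →L[ℂ] Qubits n :=
  ∑ j, (E j : ℂ) • InnerProductSpace.rankOne ℂ (b j) (b j)

/-- The initial Hamiltonian `∑ j, E j |j₊⟩⟨j₊|` with energies `E`; the unperturbed one has
`E j = h(j)`. -/
def initialHamiltonian {n : ℕ} (E : Bits n → ℝ) : Qubits n →L[ℂ] Qubits n :=
  spectralSum ketPlus E

/-- The final Hamiltonian `∑ j, E j |j⟩⟨j|` with energies `E`; the unperturbed one has
`E j = h(j)`. -/
def finalHamiltonian {n : ℕ} (E : Bits n → ℝ) : Qubits n →L[ℂ] Qubits n :=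
  spectralSum ket E

/-- The interpolation `H_s = (1 - s) H₀ + s H₁`. -/
def interpolate {n : ℕ} (H₀ H₁ : Qubits n →L[ℂ] Qubits n) (s : ℝ) : Qubits n →L[ℂ] Qubits n :=
  ((1 - s : ℝ) : ℂ) • H₀ + (s : ℂ) • H₁

/-- On the time interval `[0, τ]`, `ψ` is the evolution of the state `ψ₀` by the time-dependent
Hamiltonian `H(t) = H_{t / τ}`: it solves the Schrödinger equation `ψ' = -i H(t) ψ`
with `ψ(0) = ψ₀`. -/
def IsAdiabaticEvolution {n : ℕ} (H₀ H₁ : Qubits n →L[ℂ] Qubits n) (τ : ℝ) (ψ₀ : Qubits n)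
    (ψ : ℝ → Qubits n) : Prop :=
  ψ 0 = ψ₀ ∧ ∀ t ∈ Set.Icc 0 τ,
    HasDerivWithinAt ψ (-Complex.I • interpolate H₀ H₁ (t / τ) (ψ t)) (Set.Icc 0 τ) t

/-- The threshold `θ_h = n / 2 + √(40 n log n)`. -/
def thetaH (n : ℕ) : ℝ :=
  n / 2 + Real.sqrt (40 * n * Real.log n)

/-- The energies `E` agree with the Hamming weights, except that those of the strings of weight
above `θ_h` are perturbed by at most `ε`. -/
def IsPerturbedSpectrum {n : ℕ} (ε : ℝ) (E : Bits n → ℝ) : Prop :=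
  (∀ j, (hammingWeight j : ℝ) ≤ thetaH n → E j = hammingWeight j) ∧
    ∀ j, thetaH n < hammingWeight j → |E j - hammingWeight j| ≤ ε

end AdiabaticRobustness

end

/-! Without the perturbation both Hamiltonians are sums of one-qubit terms, so the state stays a
product `φ(t)^{⊗n}` and everything reduces to one qubit. Its Bloch vector adiabatically follows the
field `(1 - s, 0, s)`, which lies in the positive quadrant, so at all times the excited weight of
`φ` is at most `1/2 + O(τ^{-1/2})` in both eigenbases (`exists_adiabatic_qubit`). Hence the Hamming
weight of the product state, measured in either basis, has a binomial law with parameter barely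
above `1/2`, and a Chernoff bound makes its mass above `θ_h` of order `n^{-22}`
(`norm_spectralSum_tensorPow_sq_le`, `chernoff_thetaH_le`).

The perturbation therefore moves the unperturbed state by at most `ε · O(n^{-11})` at each time. The
overlap of the perturbed and unperturbed evolutions drifts no faster than that
(`norm_inner_sub_one_le`), giving a total drift `O(n^5 · n^{-11} · n^4) = O(n^{-2})`. The
perturbation is only ever applied to the unperturbed state, so the perturbed spectrum plays no role:
a gap is needed only for one qubit, where the field has length at least `√(1/2)`. -/

namespace AdiabaticRobustness

/-! ### Schrödinger equations: existence, norm conservation, comparison -/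

section Schrodinger

variable {E : Type*} [NormedAddCommGroup E] [InnerProductSpace ℂ E]

/-- The map `x ↦ 2 x / (1 + ‖x‖²)` fixes the unit sphere pointwise and is bounded. Inserted into a
linear equation, it lets one application of Picard–Lindelöf cover an arbitrarily long time interval.
-/
lemma norm_cutoff_le (x : E) : ‖(2 / (1 + ‖x‖ ^ 2)) • x‖ ≤ 1 := by
  rw [norm_smul, Real.norm_of_nonneg (by positivity), div_mul_eq_mul_div, div_le_one (by positivity)]
  nlinarith [sq_nonneg (‖x‖ - 1)]

lemma norm_cutoff_sub_le {R : ℝ} {x y : E} (hx : ‖x‖ ≤ R) (hy : ‖y‖ ≤ R) :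
    ‖(2 / (1 + ‖x‖ ^ 2)) • x - (2 / (1 + ‖y‖ ^ 2)) • y‖ ≤ (2 + 4 * R ^ 2) * ‖x - y‖ := by
  have hR : 0 ≤ R := (norm_nonneg x).trans hx
  have key : (2 / (1 + ‖x‖ ^ 2)) • x - (2 / (1 + ‖y‖ ^ 2)) • y
      = (2 / (1 + ‖x‖ ^ 2)) • (x - y)
        + (2 * (‖y‖ ^ 2 - ‖x‖ ^ 2) / ((1 + ‖x‖ ^ 2) * (1 + ‖y‖ ^ 2))) • y := by
    rw [smul_sub, sub_add, ← sub_smul]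
    congr 2
    field_simp
    ring
  rw [key, add_mul (2 : ℝ)]
  refine (norm_add_le _ _).trans (add_le_add ?_ ?_) <;> rw [norm_smul]
  · refine mul_le_mul_of_nonneg_right ?_ (norm_nonneg _)
    rw [Real.norm_of_nonneg (by positivity), div_le_iff₀ (by positivity)]
    nlinarith [sq_nonneg ‖x‖]
  · have h1 : ‖2 * (‖y‖ ^ 2 - ‖x‖ ^ 2) / ((1 + ‖x‖ ^ 2) * (1 + ‖y‖ ^ 2))‖
        ≤ 4 * R * ‖x - y‖ := by
      rw [Real.norm_eq_abs, abs_div, abs_of_pos (by positivity : (0:ℝ) < (1 + ‖x‖ ^ 2) * (1 + ‖y‖ ^ 2)),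
        div_le_iff₀ (by positivity), abs_mul, abs_two,
        show ‖y‖ ^ 2 - ‖x‖ ^ 2 = (‖y‖ + ‖x‖) * (‖y‖ - ‖x‖) by ring, abs_mul,
        abs_of_nonneg (by positivity : 0 ≤ ‖y‖ + ‖x‖)]
      have h2 : |‖y‖ - ‖x‖| ≤ ‖x - y‖ := by
        rw [abs_sub_comm]; exact abs_norm_sub_norm_le x y
      calc 2 * ((‖y‖ + ‖x‖) * |‖y‖ - ‖x‖|) ≤ 2 * ((R + R) * ‖x - y‖) := by gcongr
        _ = 4 * R * ‖x - y‖ * 1 := by ring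
        _ ≤ _ := by
          gcongr
          nlinarith [sq_nonneg ‖x‖, sq_nonneg ‖y‖, mul_nonneg (sq_nonneg ‖x‖) (sq_nonneg ‖y‖)]
    calc _ ≤ 4 * R * ‖x - y‖ * R := by gcongr
      _ = _ := by ring

/-- The norm is conserved along a flow generated by `-i c A` with `A` symmetric. -/
lemma norm_eq_of_hasDerivWithinAt {A : ℝ → E →L[ℂ] E} (hA : ∀ t, (A t : E →ₗ[ℂ] E).IsSymmetric)
    {T : ℝ} {c : ℝ → ℝ} {ψ : ℝ → E}
    (hψ : ∀ t ∈ Set.Icc 0 T,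
      HasDerivWithinAt ψ (-Complex.I • A t (c t • ψ t)) (Set.Icc 0 T) t) :
    ∀ t ∈ Set.Icc 0 T, ‖ψ t‖ = ‖ψ 0‖ := by
  have hd : ∀ t ∈ Set.Icc 0 T,
      HasDerivWithinAt (fun t => inner ℂ (ψ t) (ψ t)) 0 (Set.Icc 0 T) t := by
    intro t ht
    refine ((hψ t ht).inner ℂ (hψ t ht)).congr_deriv ?_
    have := hA t (ψ t) (ψ t)
    simp only [ContinuousLinearMap.coe_coe] at this
    rw [← Complex.coe_smul, map_smul, inner_smul_left, inner_smul_right,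
      inner_smul_left, inner_smul_right, this]
    simp
  intro t ht
  have h := norm_image_sub_le_of_norm_deriv_le_segment' (C := 0) hd (by simp) t ht
  rw [zero_mul, norm_le_zero_iff, sub_eq_zero, inner_self_eq_norm_sq_to_K,
    inner_self_eq_norm_sq_to_K] at h
  have h' : ‖ψ t‖ ^ 2 = ‖ψ 0‖ ^ 2 := by exact_mod_cast h
  exact (sq_eq_sq₀ (norm_nonneg _) (norm_nonneg _)).1 h'

/-- Linear Schrödinger equations with continuous symmetric generator have solutions on every
compact time interval, for normalised initial states. -/
theorem exists_schrodinger [CompleteSpace E] {A : ℝ → E →L[ℂ] E}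
    (hA : ∀ t, (A t : E →ₗ[ℂ] E).IsSymmetric) (hc : Continuous A) {T : ℝ} (hT : 0 ≤ T)
    {x₀ : E} (hx₀ : ‖x₀‖ = 1) :
    ∃ ψ : ℝ → E, ψ 0 = x₀ ∧
      ∀ t ∈ Set.Icc 0 T, HasDerivWithinAt ψ (-Complex.I • A t (ψ t)) (Set.Icc 0 T) t := by
  obtain ⟨M, hM⟩ := (isCompact_Icc (a := (0 : ℝ)) (b := T)).exists_bound_of_continuousOn hc.continuousOn
  have hM0 : 0 ≤ M := (norm_nonneg _).trans (hM 0 ⟨le_rfl, hT⟩)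
  lift M to NNReal using hM0
  lift T to NNReal using hT
  -- The truncated field is bounded by `M`, so a ball of radius `M T` contains the trajectory up to
  -- time `T`; the untruncated field grows with the radius and would force short steps.
  set a : NNReal := M * T with ha
  have hball : ∀ x ∈ Metric.closedBall x₀ a, ‖x‖ ≤ a + 1 := by
    intro x hx
    have := norm_le_norm_add_norm_sub' x x₀
    rw [mem_closedBall_iff_norm] at hx
    linarith
  have hPL : IsPicardLindelof (fun t x => -Complex.I • A t ((2 / (1 + ‖x‖ ^ 2)) • x))
      (tmin := 0) (tmax := T) ⟨0, le_rfl, T.2⟩ x₀ a 0 M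
      (M * (2 + 4 * (a + 1) ^ 2)) := by
    refine ⟨fun t ht => ?_, fun x _ => ?_, fun t ht x _ => ?_, ?_⟩
    · refine LipschitzOnWith.of_dist_le_mul fun x hx y hy => ?_
      rw [dist_eq_norm, dist_eq_norm, ← smul_sub, ← map_sub, norm_smul, norm_neg, Complex.norm_I,
        one_mul]
      refine ((A t).le_opNorm _).trans ?_
      calc _ ≤ M * ((2 + 4 * (a + 1) ^ 2) * ‖x - y‖) :=
            mul_le_mul (hM t ht) (norm_cutoff_sub_le (hball x hx) (hball y hy)) (norm_nonneg _) M.2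
        _ = _ := by simp [mul_assoc]
    · exact (continuous_const.smul (hc.clm_apply continuous_const)).continuousOn
    · rw [norm_smul, norm_neg, Complex.norm_I, one_mul]
      refine ((A t).le_opNorm _).trans ?_
      calc _ ≤ (M : ℝ) * 1 := mul_le_mul (hM t ht) (norm_cutoff_le x) (norm_nonneg _) M.2
        _ = M := mul_one _
    · simp [ha]
  obtain ⟨ψ, h0, hψ⟩ := hPL.exists_eq_forall_mem_Icc_hasDerivWithinAt₀
  refine ⟨ψ, h0, fun t ht => ?_⟩
  -- The cutoff is a real factor, so the truncated flow also conserves the norm; on the unit sphere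
  -- that factor equals `1` and the original equation is recovered.
  have hn := norm_eq_of_hasDerivWithinAt hA (c := fun t => 2 / (1 + ‖ψ t‖ ^ 2)) hψ t ht
  have h := hψ t ht
  rw [hn, show ψ 0 = x₀ from h0, hx₀] at h
  norm_num at h
  simpa using h

/-- If `χ` evolves by `B` and `ψ` by `A`, the overlap of the two changes at a rate bounded by the
effect of `A - B` on `χ`. -/
lemma norm_inner_sub_one_le {A B : ℝ → E →L[ℂ] E} (hA : ∀ t, (A t : E →ₗ[ℂ] E).IsSymmetric)
    {T C : ℝ} (hT : 0 ≤ T) {ψ χ : ℝ → E} (h0 : ψ 0 = χ 0) (h1 : ‖ψ 0‖ = 1)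
    (hψ : ∀ t ∈ Set.Icc 0 T, HasDerivWithinAt ψ (-Complex.I • A t (ψ t)) (Set.Icc 0 T) t)
    (hχ : ∀ t ∈ Set.Icc 0 T, HasDerivWithinAt χ (-Complex.I • B t (χ t)) (Set.Icc 0 T) t)
    (hC : ∀ t ∈ Set.Icc 0 T, ‖A t (χ t) - B t (χ t)‖ ≤ C) :
    ‖inner ℂ (ψ T) (χ T) - 1‖ ≤ C * T := by
  have hn : ∀ t ∈ Set.Icc 0 T, ‖ψ t‖ = 1 := fun t ht =>
    (norm_eq_of_hasDerivWithinAt hA (c := fun _ => 1) (by simpa using hψ) t ht).trans h1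
  -- Symmetry moves `A` from `ψ` onto `χ`, so `A - B` has to be controlled only along `χ`.
  have hd : ∀ t ∈ Set.Icc 0 T, HasDerivWithinAt (fun t => inner ℂ (ψ t) (χ t))
      (Complex.I * inner ℂ (ψ t) (A t (χ t) - B t (χ t))) (Set.Icc 0 T) t := by
    intro t ht
    refine ((hψ t ht).inner ℂ (hχ t ht)).congr_deriv ?_
    have := hA t (ψ t) (χ t)
    simp only [ContinuousLinearMap.coe_coe] at this
    rw [inner_smul_left, inner_smul_right, inner_sub_right, this]
    simp
    ring
  have h := norm_image_sub_le_of_norm_deriv_le_segment' hd (C := C) (fun t ht => ?_) T ⟨hT, le_rfl⟩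
  · rw [← h0, inner_self_eq_norm_sq_to_K, h1] at h
    simpa using h
  · have ht' := Set.Ico_subset_Icc_self ht
    rw [norm_mul, Complex.norm_I, one_mul]
    refine (norm_inner_le_norm _ _).trans ?_
    rw [hn t ht', one_mul]
    exact hC t ht'

/-- Two unit vectors with overlap close to `1` are close. -/
lemma norm_sub_sq_le {x y : E} (hx : ‖x‖ = 1) (hy : ‖y‖ = 1) {c : ℝ}
    (h : ‖inner ℂ x y - 1‖ ≤ c) : ‖x - y‖ ^ 2 ≤ 2 * c := by
  have h1 : ‖x - y‖ ^ 2 = 2 - 2 * (inner ℂ x y : ℂ).re := by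
    rw [@norm_sub_sq ℂ, hx, hy]
    simp
    ring
  have h2 := (Complex.abs_re_le_norm (inner ℂ x y - 1)).trans h
  rw [abs_le] at h2
  simp at h2
  linarith

/-- Two unit vectors whose overlap has modulus close to `1` are close up to a phase. -/
lemma exists_phase {x y : E} (hx : ‖x‖ = 1) (hy : ‖y‖ = 1) {c : ℝ}
    (h : 1 - c ≤ ‖(inner ℂ y x : ℂ)‖) : ∃ γ : ℂ, ‖γ‖ = 1 ∧ ‖x - γ • y‖ ^ 2 ≤ 2 * c := by
  obtain ⟨γ, hγ, hγ'⟩ : ∃ γ : ℂ, ‖γ‖ = 1 ∧ (inner ℂ y x : ℂ) = ‖(inner ℂ y x : ℂ)‖ * γ := by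
    by_cases h0 : (inner ℂ y x : ℂ) = 0
    · exact ⟨1, by simp, by simp [h0]⟩
    · have h0' : (‖(inner ℂ y x : ℂ)‖ : ℂ) ≠ 0 := by simpa using h0
      refine ⟨inner ℂ y x / ‖(inner ℂ y x : ℂ)‖, ?_, by field_simp⟩
      rw [norm_div, Complex.norm_real, norm_norm, div_self (by simpa using h0)]
  refine ⟨γ, hγ, norm_sub_sq_le hx (by rw [norm_smul, hγ, hy, one_mul]) ?_⟩
  have hle : ‖(inner ℂ y x : ℂ)‖ ≤ 1 := by simpa [hx, hy] using norm_inner_le_norm (𝕜 := ℂ) y x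
  have : inner ℂ x (γ • y) = (‖(inner ℂ y x : ℂ)‖ : ℂ) := by
    rw [inner_smul_right, ← inner_conj_symm, hγ']
    simp only [map_mul, Complex.conj_ofReal, norm_mul, hγ, mul_one, Complex.norm_real, norm_norm]
    rw [mul_left_comm, Complex.mul_conj, Complex.normSq_eq_norm_sq, hγ]
    simp
  rw [this, ← Complex.ofReal_one, ← Complex.ofReal_sub, Complex.norm_real, Real.norm_eq_abs, abs_le]
  constructor <;> linarith [norm_nonneg (inner ℂ y x : ℂ)]

end Schrodinger

/-! ### Adiabatic theorem for the Bloch vector -/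

section Bloch

/-- The squared length of the field `(1 - s, 0, s)` is at least `1 / 2`. -/
lemma field_sq_ge_half (s : ℝ) : 1 / 2 ≤ (1 - s) ^ 2 + s ^ 2 := by nlinarith [sq_nonneg (2 * s - 1)]

/-- Adiabatic estimate for the Bloch vector `(x, y, z)` precessing around the field
`(1 - s, 0, s)`, `s = t / τ`: its component along the field stays within `21 / τ` of `1`. -/
lemma bloch_field_component_ge {τ : ℝ} (hτ : 0 < τ) {x y z : ℝ → ℝ}
    (hx0 : x 0 = 1) (hy0 : y 0 = 0) (hz0 : z 0 = 0)
    (hx : ∀ t ∈ Set.Icc 0 τ, HasDerivWithinAt x (t / τ * y t) (Set.Icc 0 τ) t)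
    (hy : ∀ t ∈ Set.Icc 0 τ,
      HasDerivWithinAt y ((1 - t / τ) * z t - t / τ * x t) (Set.Icc 0 τ) t)
    (hz : ∀ t ∈ Set.Icc 0 τ, HasDerivWithinAt z (-((1 - t / τ) * y t)) (Set.Icc 0 τ) t)
    (hy1 : ∀ t ∈ Set.Icc 0 τ, |y t| ≤ 1) :
    ∀ t ∈ Set.Icc 0 τ, 1 - 21 / τ ≤
      ((1 - t / τ) * x t + t / τ * z t) / √((1 - t / τ) ^ 2 + (t / τ) ^ 2) := by
  set r : ℝ → ℝ := fun t => √((1 - t / τ) ^ 2 + (t / τ) ^ 2) with hr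
  have hr2 : ∀ t, r t ^ 2 = (1 - t / τ) ^ 2 + (t / τ) ^ 2 := fun t => Real.sq_sqrt (by positivity)
  have hrlow : ∀ t, 7 / 10 ≤ r t := fun t =>
    Real.le_sqrt_of_sq_le (by linarith [field_sq_ge_half (t / τ)])
  have hrpos : ∀ t, 0 < r t := fun t => by linarith [hrlow t]
  have hs : ∀ t, HasDerivWithinAt (fun t => t / τ) (1 / τ) (Set.Icc 0 τ) t := fun t =>
    (hasDerivWithinAt_id t _).div_const τ
  have hrd : ∀ t, HasDerivWithinAt r ((2 * (t / τ) - 1) / (r t * τ)) (Set.Icc 0 τ) t := by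
    intro t
    have h := ((((hs t).const_sub 1).pow 2).add ((hs t).pow 2)).sqrt
      (by simpa using (by linarith [field_sq_ge_half (t / τ)] : (1 - t / τ) ^ 2 + (t / τ) ^ 2 ≠ 0))
    refine h.congr_deriv ?_
    have h1 := (hrpos t).ne'
    simp only [hr] at h1 ⊢
    simp only [Pi.add_apply, Pi.pow_apply]
    generalize √((1 - t / τ) ^ 2 + (t / τ) ^ 2) = R at h1 ⊢
    rw [show 2 - 1 = 1 from rfl]
    push_cast
    field_simp
    ring
  -- Integration by parts: the field component has derivative exactly `y' / (r³ τ)`. Subtracting `y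
  -- / (r³ τ)` leaves only the derivative of the slow factor `1 / (r³ τ)`, which is `O(τ⁻²)` and
  -- integrates to `O(τ⁻¹)`.
  set F : ℝ → ℝ := fun t => ((1 - t / τ) * x t + t / τ * z t) / r t - y t / (r t ^ 3 * τ) with hF
  have hFd : ∀ t ∈ Set.Icc 0 τ, HasDerivWithinAt F
      (3 * y t * (2 * (t / τ) - 1) / (r t ^ 5 * τ ^ 2)) (Set.Icc 0 τ) t := by
    intro t ht
    have h1 := (hrpos t).ne'
    have h := (((((hs t).const_sub 1).mul (hx t ht)).add ((hs t).mul (hz t ht))).div (hrd t)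
      h1).sub ((hy t ht).div (((hrd t).pow 3).mul_const τ) (mul_ne_zero (pow_ne_zero 3 h1) hτ.ne'))
    refine h.congr_deriv ?_
    simp only [Pi.add_apply, Pi.pow_apply, Pi.mul_apply]
    have h2 := hr2 t
    obtain ⟨s, hs'⟩ : ∃ s, s = t / τ := ⟨_, rfl⟩
    rw [← hs'] at h2 ⊢
    generalize r t = R at *
    generalize x t = X at *
    generalize y t = Y at *
    generalize z t = Z at *
    have h3 : Z * (R ^ 2 - (2 * s - 1) * s - (1 - s)) = 0 := by rw [h2]; ring
    have h4 : X * (-R ^ 2 - (2 * s - 1) * (1 - s) + s) = 0 := by rw [h2]; ring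
    field_simp
    push_cast
    linear_combination (R ^ 4 * τ) * (h3 + h4)
  intro t ht
  -- With `r ≥ 7/10`, one has `3 / r⁵ ≤ 18` here and `1 / r³ ≤ 3` for the boundary term below; hence
  -- `21 = 18 + 3`.
  have hbound : ∀ t ∈ Set.Ico 0 τ,
      ‖3 * y t * (2 * (t / τ) - 1) / (r t ^ 5 * τ ^ 2)‖ ≤ 18 / τ ^ 2 := by
    intro t ht
    have h5 : (7 / 10 : ℝ) ^ 5 ≤ r t ^ 5 := by gcongr; exact hrlow t
    have hr5 : 0 < r t ^ 5 := pow_pos (hrpos t) 5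
    have h6 : |2 * (t / τ) - 1| ≤ 1 := by
      have h7 : 0 ≤ t / τ := div_nonneg ht.1 hτ.le
      have h8 : t / τ ≤ 1 := (div_le_one hτ).2 ht.2.le
      rw [abs_le]; constructor <;> linarith
    rw [Real.norm_eq_abs, abs_div, abs_of_pos (by positivity : 0 < r t ^ 5 * τ ^ 2),
      div_le_div_iff₀ (by positivity) (by positivity), abs_mul, abs_mul, abs_of_pos three_pos]
    calc 3 * |y t| * |2 * (t / τ) - 1| * τ ^ 2 ≤ 3 * 1 * 1 * τ ^ 2 := by
          gcongr
          exact hy1 t (Set.Ico_subset_Icc_self ht)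
      _ ≤ 18 * r t ^ 5 * τ ^ 2 := by
          refine mul_le_mul_of_nonneg_right ?_ (sq_nonneg τ)
          norm_num at h5
          linarith
      _ = _ := by ring
  have h := norm_image_sub_le_of_norm_deriv_le_segment' hFd hbound t ht
  have hF0 : F 0 = 1 := by simp [hF, hr, hx0, hy0, hz0]
  have h1 : 18 / τ ^ 2 * (t - 0) ≤ 18 / τ := by
    rw [div_mul_eq_mul_div, div_le_div_iff₀ (by positivity) hτ]
    nlinarith [mul_le_mul_of_nonneg_right ht.2 hτ.le]
  have h2 : |y t / (r t ^ 3 * τ)| ≤ 3 / τ := by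
    have h5 : (7 / 10 : ℝ) ^ 3 ≤ r t ^ 3 := by gcongr; exact hrlow t
    have hr5 : 0 < r t ^ 3 := pow_pos (hrpos t) 3
    rw [abs_div, abs_of_pos (by positivity : 0 < r t ^ 3 * τ),
      div_le_div_iff₀ (by positivity) hτ]
    calc |y t| * τ ≤ 1 * τ := by gcongr; exact hy1 t ht
      _ ≤ 3 * r t ^ 3 * τ := by
          refine mul_le_mul_of_nonneg_right ?_ hτ.le
          norm_num at h5
          linarith
      _ = _ := by ring
  rw [hF0, Real.norm_eq_abs, abs_le] at h
  rw [abs_le] at h2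
  have h3 : 21 / τ = 18 / τ + 3 / τ := by ring
  have h4 : F t = ((1 - t / τ) * x t + t / τ * z t) / r t - y t / (r t ^ 3 * τ) := rfl
  rw [h3]
  linarith [h.1, h2.1, h2.2]

/-- The length of the Bloch vector is conserved. -/
lemma bloch_sq_sum {τ : ℝ} {x y z : ℝ → ℝ}
    (hx0 : x 0 = 1) (hy0 : y 0 = 0) (hz0 : z 0 = 0)
    (hx : ∀ t ∈ Set.Icc 0 τ, HasDerivWithinAt x (t / τ * y t) (Set.Icc 0 τ) t)
    (hy : ∀ t ∈ Set.Icc 0 τ,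
      HasDerivWithinAt y ((1 - t / τ) * z t - t / τ * x t) (Set.Icc 0 τ) t)
    (hz : ∀ t ∈ Set.Icc 0 τ, HasDerivWithinAt z (-((1 - t / τ) * y t)) (Set.Icc 0 τ) t) :
    ∀ t ∈ Set.Icc 0 τ, x t ^ 2 + y t ^ 2 + z t ^ 2 = 1 := by
  intro t ht
  have hd : ∀ t ∈ Set.Icc 0 τ, HasDerivWithinAt (fun t => x t ^ 2 + y t ^ 2 + z t ^ 2) 0
      (Set.Icc 0 τ) t := fun t ht => by
    refine ((((hx t ht).pow 2).add ((hy t ht).pow 2)).add ((hz t ht).pow 2)).congr_deriv ?_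
    push_cast
    ring
  have h := norm_image_sub_le_of_norm_deriv_le_segment' (C := 0) hd (by simp) t ht
  rw [zero_mul, norm_le_zero_iff, sub_eq_zero] at h
  simpa [hx0, hy0, hz0] using h

/-- A Bloch vector almost aligned with the field has almost nonnegative components. -/
lemma neg_le_of_aligned {s x z κ : ℝ} (hs0 : 0 ≤ s) (hs1 : s ≤ 1) (hκ0 : 0 ≤ κ) (hκ : κ ≤ 1)
    (hxz : x ^ 2 + z ^ 2 ≤ 1)
    (h : 1 - κ ≤ ((1 - s) * x + s * z) / √((1 - s) ^ 2 + s ^ 2)) :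
    -(2 * √κ) ≤ x ∧ -(2 * √κ) ≤ z := by
  have hq := field_sq_ge_half s
  set r := √((1 - s) ^ 2 + s ^ 2) with hr
  have hr2 : r ^ 2 = (1 - s) ^ 2 + s ^ 2 := Real.sq_sqrt (by positivity)
  have hr0 : 0 < r := Real.sqrt_pos.2 (by linarith)
  rw [le_div_iff₀ hr0] at h
  -- Here `e` and `w` are `r` times the components along and across the field. Alignment forces `w²
  -- ≤ 2 κ r²`. In recovering `x` and `z`, `e` enters with nonnegative coefficients, so only `w` can
  -- make them negative.
  set e := (1 - s) * x + s * z with he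
  set w := (1 - s) * z - s * x with hw
  have he0 : 0 ≤ e := le_trans (mul_nonneg (by linarith) hr0.le) h
  have h1 : (1 - κ) ^ 2 * r ^ 2 ≤ e ^ 2 := by
    rw [← mul_pow]; exact pow_le_pow_left₀ (mul_nonneg (by linarith) hr0.le) h 2
  have h2 : e ^ 2 + w ^ 2 ≤ r ^ 2 := by
    have : e ^ 2 + w ^ 2 = r ^ 2 * (x ^ 2 + z ^ 2) := by rw [hr2, he, hw]; ring
    rw [this]
    exact mul_le_of_le_one_right (sq_nonneg r) hxz
  have h3 : w ^ 2 ≤ 2 * κ * r ^ 2 := by nlinarith [sq_nonneg (κ * r)]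
  have h4 : |w| ≤ 2 * √κ * r ^ 2 := by
    refine abs_le_of_sq_le_sq ?_ (by positivity)
    have h5 : (2 * √κ * r ^ 2) ^ 2 = 4 * κ * (r ^ 2) * r ^ 2 := by
      rw [mul_pow, mul_pow, Real.sq_sqrt hκ0]; ring
    rw [h5]
    have : 2 * κ * r ^ 2 * 1 ≤ 2 * κ * r ^ 2 * (2 * r ^ 2) := by
      gcongr
      linarith
    linarith
  have hz : r ^ 2 * z = s * e + (1 - s) * w := by rw [hr2, he, hw]; ring
  have hx : r ^ 2 * x = (1 - s) * e - s * w := by rw [hr2, he, hw]; ring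
  have hr2' : 0 < r ^ 2 := by positivity
  rw [abs_le] at h4
  have hk : 0 ≤ 2 * √κ * r ^ 2 := by positivity
  constructor
  · refine le_of_mul_le_mul_left ?_ hr2'
    rw [hx]
    nlinarith [mul_nonneg (sub_nonneg.2 hs1) he0, mul_le_mul_of_nonneg_left h4.2 hs0,
      mul_le_mul_of_nonneg_right hs1 hk]
  · refine le_of_mul_le_mul_left ?_ hr2'
    rw [hz]
    nlinarith [mul_nonneg hs0 he0, mul_le_mul_of_nonneg_left h4.1 (sub_nonneg.2 hs1),
      mul_nonneg hs0 hk]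

end Bloch

/-! ### Adiabatic evolution of one qubit -/

section Qubit

/-- The one-qubit Schrödinger equation for `(1 - s) |-⟩⟨-| + s |1⟩⟨1|` with initial state `|+⟩`. -/
lemma exists_qubit {τ : ℝ} (hτ : 0 ≤ τ) : ∃ a b : ℝ → ℂ,
    a 0 = ((1 / √2 : ℝ) : ℂ) ∧ b 0 = ((1 / √2 : ℝ) : ℂ) ∧
    (∀ t ∈ Set.Icc 0 τ, HasDerivWithinAt a
      (-Complex.I * (((1 - t / τ : ℝ) : ℂ) * ((a t - b t) / 2))) (Set.Icc 0 τ) t) ∧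
    (∀ t ∈ Set.Icc 0 τ, HasDerivWithinAt b
      (-Complex.I * (((1 - t / τ : ℝ) : ℂ) * ((b t - a t) / 2) + ((t / τ : ℝ) : ℂ) * b t))
      (Set.Icc 0 τ) t) := by
  set M : ℝ → Matrix (Fin 2) (Fin 2) ℂ := fun t =>
    ((1 - t / τ : ℝ) : ℂ) • !![1 / 2, -1 / 2; -1 / 2, 1 / 2] + ((t / τ : ℝ) : ℂ) • !![0, 0; 0, 1]
    with hM
  have hs : ∀ t, (Matrix.toEuclideanCLM (n := Fin 2) (𝕜 := ℂ) (M t) :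
      EuclideanSpace ℂ (Fin 2) →ₗ[ℂ] EuclideanSpace ℂ (Fin 2)).IsSymmetric := by
    intro t
    refine (ContinuousLinearMap.isSelfAdjoint_iff_isSymmetric).1 ?_
    refine IsSelfAdjoint.map (f := Matrix.toEuclideanCLM (n := Fin 2) (𝕜 := ℂ)) ?_
    ext i j
    fin_cases i <;> fin_cases j <;> simp [hM, Matrix.star_apply]
  have hc : Continuous fun t => Matrix.toEuclideanCLM (n := Fin 2) (𝕜 := ℂ) (M t) := by
    have : Continuous M := by simp only [hM]; fun_prop
    exact (LinearMap.continuous_of_finiteDimensional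
      (Matrix.toEuclideanCLM (n := Fin 2) (𝕜 := ℂ)).toAlgEquiv.toLinearMap).comp this
  have h2 : (0 : ℝ) < √2 := by positivity
  obtain ⟨φ, h0, hφ⟩ := exists_schrodinger hs hc hτ
    (x₀ := !₂[((1 / √2 : ℝ) : ℂ), ((1 / √2 : ℝ) : ℂ)]) (by
      rw [EuclideanSpace.norm_eq]
      simp
      norm_num)
  have hcoord : ∀ i, ∀ t ∈ Set.Icc 0 τ, HasDerivWithinAt (fun t => φ t i)
      (-Complex.I * ((M t).mulVec (φ t).ofLp i)) (Set.Icc 0 τ) t := fun i t ht => by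
    have := (EuclideanSpace.proj (𝕜 := ℂ) i : EuclideanSpace ℂ (Fin 2) →L[ℂ] ℂ).restrictScalars ℝ
      |>.hasFDerivAt.comp_hasDerivWithinAt t (hφ t ht)
    exact this
  refine ⟨fun t => φ t 0, fun t => φ t 1, by simp [h0], by simp [h0], fun t ht => ?_, fun t ht => ?_⟩
  · refine (hcoord 0 t ht).congr_deriv ?_
    simp [hM, Matrix.mulVec, dotProduct, Fin.sum_univ_two]
    ring
  · refine (hcoord 1 t ht).congr_deriv ?_
    simp [hM, Matrix.mulVec, dotProduct, Fin.sum_univ_two]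
    ring

/-- Adiabatic evolution of one qubit: the state stays normalised, its weight on the excited states
of both Hamiltonians hardly exceeds `1 / 2`, and it ends up close to `|0⟩`. -/
lemma exists_adiabatic_qubit {τ : ℝ} (hτ : 21 ≤ τ) : ∃ a b : ℝ → ℂ,
    a 0 = ((1 / √2 : ℝ) : ℂ) ∧ b 0 = ((1 / √2 : ℝ) : ℂ) ∧
    (∀ t ∈ Set.Icc 0 τ, HasDerivWithinAt a
      (-Complex.I * (((1 - t / τ : ℝ) : ℂ) * ((a t - b t) / 2))) (Set.Icc 0 τ) t) ∧
    (∀ t ∈ Set.Icc 0 τ, HasDerivWithinAt b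
      (-Complex.I * (((1 - t / τ : ℝ) : ℂ) * ((b t - a t) / 2) + ((t / τ : ℝ) : ℂ) * b t))
      (Set.Icc 0 τ) t) ∧
    (∀ t ∈ Set.Icc 0 τ, ‖a t‖ ^ 2 + ‖b t‖ ^ 2 = 1 ∧ ‖b t‖ ^ 2 ≤ 1 / 2 + √(21 / τ) ∧
      ‖a t - b t‖ ^ 2 / 2 ≤ 1 / 2 + √(21 / τ)) ∧
    1 - 21 / τ / 2 ≤ ‖a τ‖ ^ 2 := by
  have hτ0 : 0 < τ := by linarith
  obtain ⟨a, b, ha0, hb0, ha, hb⟩ := exists_qubit hτ0.le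
  have hre : ∀ {f : ℝ → ℂ} {f' : ℂ} {t : ℝ}, HasDerivWithinAt f f' (Set.Icc 0 τ) t →
      HasDerivWithinAt (fun t => (f t).re) f'.re (Set.Icc 0 τ) t := fun h =>
    Complex.reCLM.hasFDerivAt.comp_hasDerivWithinAt _ h
  have him : ∀ {f : ℝ → ℂ} {f' : ℂ} {t : ℝ}, HasDerivWithinAt f f' (Set.Icc 0 τ) t →
      HasDerivWithinAt (fun t => (f t).im) f'.im (Set.Icc 0 τ) t := fun h =>
    Complex.imCLM.hasFDerivAt.comp_hasDerivWithinAt _ h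
  -- Pauli expectations of `(a, b)`. For a unit state the weights on `|-⟩` and `|1⟩` are `(1 - x) /
  -- 2` and `(1 - z) / 2`, so lower bounds on `x` and `z` bound both excitations.
  set x : ℝ → ℝ := fun t => 2 * ((a t).re * (b t).re + (a t).im * (b t).im) with hx
  set y : ℝ → ℝ := fun t => 2 * ((a t).re * (b t).im - (a t).im * (b t).re) with hy
  set z : ℝ → ℝ := fun t => ((a t).re ^ 2 + (a t).im ^ 2) - ((b t).re ^ 2 + (b t).im ^ 2) with hz
  have h2 : (√2)⁻¹ * (√2)⁻¹ = (1 / 2 : ℝ) := by rw [← mul_inv, Real.mul_self_sqrt two_pos.le]; simp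
  have hx0 : x 0 = 1 := by
    simp only [hx, ha0, hb0, Complex.ofReal_re, Complex.ofReal_im, one_div, h2]
    norm_num
  have hy0 : y 0 = 0 := by simp [hy, ha0, hb0]
  have hz0 : z 0 = 0 := by simp [hz, ha0, hb0]
  have hxd : ∀ t ∈ Set.Icc 0 τ, HasDerivWithinAt x (t / τ * y t) (Set.Icc 0 τ) t := fun t ht => by
    refine ((((hre (ha t ht)).mul (hre (hb t ht))).add
      ((him (ha t ht)).mul (him (hb t ht)))).const_mul 2).congr_deriv ?_
    simp [hy]
    ring
  have hyd : ∀ t ∈ Set.Icc 0 τ,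
      HasDerivWithinAt y ((1 - t / τ) * z t - t / τ * x t) (Set.Icc 0 τ) t := fun t ht => by
    refine ((((hre (ha t ht)).mul (him (hb t ht))).sub
      ((him (ha t ht)).mul (hre (hb t ht)))).const_mul 2).congr_deriv ?_
    simp [hx, hz]
    ring
  have hzd : ∀ t ∈ Set.Icc 0 τ,
      HasDerivWithinAt z (-((1 - t / τ) * y t)) (Set.Icc 0 τ) t := fun t ht => by
    refine ((((hre (ha t ht)).pow 2).add ((him (ha t ht)).pow 2)).sub
      (((hre (hb t ht)).pow 2).add ((him (hb t ht)).pow 2))).congr_deriv ?_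
    simp [hy]
    ring
  have hsum := bloch_sq_sum hx0 hy0 hz0 hxd hyd hzd
  have hcomp := bloch_field_component_ge hτ0 hx0 hy0 hz0 hxd hyd hzd fun t ht => by
    rw [abs_le_one_iff_mul_self_le_one]
    nlinarith [hsum t ht, sq_nonneg (x t), sq_nonneg (z t)]
  have hna : ∀ t, ‖a t‖ ^ 2 = (a t).re ^ 2 + (a t).im ^ 2 := fun t => by
    rw [Complex.sq_norm, Complex.normSq_apply]; ring
  have hnb : ∀ t, ‖b t‖ ^ 2 = (b t).re ^ 2 + (b t).im ^ 2 := fun t => by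
    rw [Complex.sq_norm, Complex.normSq_apply]; ring
  have hz' : ∀ t, z t = ‖a t‖ ^ 2 - ‖b t‖ ^ 2 := fun t => by rw [hna, hnb]
  have hn : ∀ t ∈ Set.Icc 0 τ, ‖a t‖ ^ 2 + ‖b t‖ ^ 2 = 1 := fun t ht => by
    have h : (‖a t‖ ^ 2 + ‖b t‖ ^ 2) ^ 2 = 1 ^ 2 := by
      rw [one_pow, ← hsum t ht, hna, hnb]
      simp only [hx, hy, hz]
      ring
    exact (sq_eq_sq₀ (by positivity) zero_le_one).1 h
  refine ⟨a, b, ha0, hb0, ha, hb, fun t ht => ?_, ?_⟩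
  · have hs0 : 0 ≤ t / τ := div_nonneg ht.1 hτ0.le
    have hs1 : t / τ ≤ 1 := (div_le_one hτ0).2 ht.2
    obtain ⟨h3, h4⟩ := neg_le_of_aligned hs0 hs1 (by positivity) ((div_le_one hτ0).2 hτ)
      (by nlinarith [hsum t ht, sq_nonneg (y t)]) (hcomp t ht)
    have h5 : ‖a t - b t‖ ^ 2 = ‖a t‖ ^ 2 + ‖b t‖ ^ 2 - x t := by
      rw [Complex.sq_norm, Complex.normSq_apply, hna, hnb]
      simp only [hx, Complex.sub_re, Complex.sub_im]
      ring
    rw [hz'] at h4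
    have h6 := hn t ht
    exact ⟨h6, by linarith, by linarith⟩
  · have hmem : τ ∈ Set.Icc 0 τ := ⟨hτ0.le, le_rfl⟩
    have h3 := hcomp τ hmem
    rw [div_self hτ0.ne'] at h3
    simp only [sub_self, zero_mul, one_mul, zero_add, ne_eq, OfNat.ofNat_ne_zero, not_false_eq_true,
      zero_pow, one_pow, Real.sqrt_one, div_one] at h3
    rw [hz'] at h3
    linarith [hn τ hmem]

end Qubit

/-! ### Product states and Hamming-weight tails -/

section Product

variable {n : ℕ}

/-- The product state with amplitude `∏ k, φ (x k)` on `|x⟩`. -/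
noncomputable def tensorPow (n : ℕ) (φ : Fin 2 → ℂ) : Qubits n := WithLp.toLp 2 fun x => ∏ k, φ (x k)

/-- The product basis `⨂ k, U |j k⟩` obtained from a one-qubit gate `U`. -/
noncomputable def productBasis (U : Matrix (Fin 2) (Fin 2) ℂ) (j : Bits n) : Qubits n :=
  WithLp.toLp 2 fun x => ∏ k, U (x k) (j k)

/-- Together with `ket_eq`, this lets each product-basis statement serve both Hamiltonians, with
gate `hadamard` or `1`. -/
lemma ketPlus_eq : (ketPlus : Bits n → Qubits n) = productBasis hadamard := rfl

lemma ket_eq : (ket : Bits n → Qubits n) = productBasis 1 := by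
  ext j x
  simp only [ket, productBasis, Matrix.one_apply, PiLp.single_apply]
  rw [Finset.prod_ite_zero]
  simp [funext_iff]

/-- Distributivity; this is what turns sums over all `2 ^ n` strings into one-qubit computations. -/
lemma sum_bits_prod {R : Type*} [CommSemiring R] (f : Fin n → Fin 2 → R) :
    ∑ x : Bits n, ∏ k, f k (x k) = ∏ k, ∑ a, f k a := by
  rw [Finset.prod_univ_sum, Fintype.piFinset_univ]

lemma inner_productBasis_tensorPow (U : Matrix (Fin 2) (Fin 2) ℂ) (φ : Fin 2 → ℂ) (j : Bits n) :
    inner ℂ (productBasis U j) (tensorPow n φ) = ∏ k, (U.conjTranspose.mulVec φ) (j k) := by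
  simp only [PiLp.inner_apply, productBasis, tensorPow, RCLike.inner_apply, map_prod,
    ← Finset.prod_mul_distrib]
  rw [sum_bits_prod fun k a => φ a * (starRingEnd ℂ) (U a (j k))]
  simp [Matrix.mulVec, dotProduct, Matrix.conjTranspose_apply, mul_comm]

lemma orthonormal_productBasis {U : Matrix (Fin 2) (Fin 2) ℂ} (hU : U.conjTranspose * U = 1) :
    Orthonormal ℂ (productBasis U : Bits n → Qubits n) := by
  rw [orthonormal_iff_ite]
  intro i j
  have h : inner ℂ (productBasis U i) (productBasis U j)
      = ∏ k, (1 : Matrix (Fin 2) (Fin 2) ℂ) (i k) (j k) := by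
    simp only [PiLp.inner_apply, productBasis, RCLike.inner_apply, map_prod,
      ← Finset.prod_mul_distrib]
    rw [sum_bits_prod fun k a => U a (j k) * (starRingEnd ℂ) (U a (i k)), ← hU]
    simp [Matrix.mul_apply, Matrix.conjTranspose_apply, mul_comm]
  rw [h]
  simp only [Matrix.one_apply]
  rw [Finset.prod_ite_zero]
  simp [funext_iff]

lemma norm_tensorPow_sq (φ : Fin 2 → ℂ) :
    ‖tensorPow n φ‖ ^ 2 = (‖φ 0‖ ^ 2 + ‖φ 1‖ ^ 2) ^ n := by
  rw [EuclideanSpace.norm_sq_eq]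
  simp only [tensorPow, norm_prod, ← Finset.prod_pow]
  rw [sum_bits_prod fun _ a => ‖φ a‖ ^ 2]
  simp

lemma spectralSum_apply (b : Bits n → Qubits n) (E : Bits n → ℝ) (v : Qubits n) :
    spectralSum b E v = ∑ j, ((E j : ℂ) * inner ℂ (b j) v) • b j := by
  simp only [spectralSum, sum_apply, smul_apply,
    InnerProductSpace.rankOne_apply, smul_smul]

lemma spectralSum_sub (b : Bits n → Qubits n) (E F : Bits n → ℝ) :
    spectralSum b E - spectralSum b F = spectralSum b (E - F) := by
  simp [spectralSum, sub_smul, Finset.sum_sub_distrib]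

lemma isSymmetric_spectralSum (b : Bits n → Qubits n) (E : Bits n → ℝ) :
    (spectralSum b E : Qubits n →ₗ[ℂ] Qubits n).IsSymmetric := by
  intro v w
  simp only [ContinuousLinearMap.coe_coe, spectralSum_apply, sum_inner, inner_sum, inner_smul_left,
    inner_smul_right, map_mul, Complex.conj_ofReal, inner_conj_symm]
  exact Finset.sum_congr rfl fun j _ => by ring

lemma hammingWeight_eq_sum (j : Bits n) :
    ((hammingWeight j : ℝ) : ℂ) = ∑ k, if j k = 1 then (1 : ℂ) else 0 := by
  simp [hammingWeight]

/-- The total excitation number acts on product states as a sum of one-qubit operators. -/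
lemma spectralSum_hammingWeight_tensorPow {U : Matrix (Fin 2) (Fin 2) ℂ}
    (hU : U * U.conjTranspose = 1) (φ : Fin 2 → ℂ) (x : Bits n) :
    spectralSum (productBasis U) (fun j => (hammingWeight j : ℝ)) (tensorPow n φ) x =
      ∑ k, (∏ l ∈ Finset.univ.erase k, φ (x l)) *
        (U (x k) 1 * U.conjTranspose.mulVec φ 1) := by
  set c := U.conjTranspose.mulVec φ with hc
  have hφ : ∀ a, ∑ i, U a i * c i = φ a := fun a => by
    have : U.mulVec c = φ := by rw [hc, Matrix.mulVec_mulVec, hU, Matrix.one_mulVec]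
    exact congrFun this a
  rw [spectralSum_apply]
  simp only [WithLp.ofLp_sum, Finset.sum_apply, PiLp.smul_apply, smul_eq_mul,
    inner_productBasis_tensorPow, ← hc, hammingWeight_eq_sum, Finset.sum_mul]
  rw [Finset.sum_comm]
  refine Finset.sum_congr rfl fun k _ => ?_
  -- Absorbing the indicator into the factor at `k` makes the summand a pure product. After
  -- summation the factors `l ≠ k` give back `φ (x l)`, and factor `k` keeps only its excited part.
  have h : ∀ j : Bits n, ((if j k = 1 then (1 : ℂ) else 0) * ∏ l, c (j l)) * productBasis U j x
      = ∏ l, (if l = k then (if j l = 1 then U (x l) (j l) * c (j l) else 0)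
          else U (x l) (j l) * c (j l)) := by
    intro j
    rw [← Finset.mul_prod_erase Finset.univ (fun l => ite (l = k) _ _) (Finset.mem_univ k),
      if_pos rfl, Finset.prod_congr (g := fun l => U (x l) (j l) * c (j l)) rfl
        fun l hl => if_neg (Finset.ne_of_mem_erase hl)]
    simp only [productBasis]
    rw [mul_assoc, ← Finset.prod_mul_distrib,
      ← Finset.mul_prod_erase Finset.univ _ (Finset.mem_univ k)]
    split_ifs <;> simp [mul_comm]
  simp only [h]
  rw [sum_bits_prod fun l a => if l = k then (if a = 1 then U (x l) a * c a else 0)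
    else U (x l) a * c a, ← Finset.mul_prod_erase Finset.univ _ (Finset.mem_univ k), mul_comm]
  congr 1
  · refine Finset.prod_congr rfl fun l hl => ?_
    simp only [if_neg (Finset.ne_of_mem_erase hl), hφ]
  · simp

/-- Chernoff bound for the effect of a perturbation of the energies of strings with large weight on
a product state. -/
lemma norm_spectralSum_tensorPow_sq_le {U : Matrix (Fin 2) (Fin 2) ℂ}
    (hU : U.conjTranspose * U = 1) (φ : Fin 2 → ℂ) {d : Bits n → ℝ} {θ δ lam : ℝ} (hlam : 0 ≤ lam)
    (hd0 : ∀ j, (hammingWeight j : ℝ) ≤ θ → d j = 0)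
    (hd : ∀ j, θ < hammingWeight j → |d j| ≤ δ) :
    ‖spectralSum (productBasis U) d (tensorPow n φ)‖ ^ 2 ≤
      δ ^ 2 * (Real.exp (-(lam * θ)) * (‖U.conjTranspose.mulVec φ 0‖ ^ 2 +
        Real.exp lam * ‖U.conjTranspose.mulVec φ 1‖ ^ 2) ^ n) := by
  set c := U.conjTranspose.mulVec φ with hc
  -- Parseval: the mean of `d²` against the product weights `∏ k, ‖c (j k)‖²`.
  have h1 : ‖spectralSum (productBasis U) d (tensorPow n φ)‖ ^ 2 =
      ∑ j : Bits n, d j ^ 2 * ∏ k, ‖c (j k)‖ ^ 2 := by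
    have h2 : (‖spectralSum (productBasis U) d (tensorPow n φ)‖ ^ 2 : ℂ) =
        ((∑ j : Bits n, d j ^ 2 * ∏ k, ‖c (j k)‖ ^ 2 : ℝ) : ℂ) := by
      refine (inner_self_eq_norm_sq_to_K (𝕜 := ℂ)
        (spectralSum (productBasis U) d (tensorPow n φ))).symm.trans ?_
      rw [spectralSum_apply, (orthonormal_productBasis hU).inner_sum]
      push_cast
      refine Finset.sum_congr rfl fun j _ => ?_
      rw [mul_comm, ← RCLike.inner_apply, inner_self_eq_norm_sq_to_K,
        inner_productBasis_tensorPow, ← hc]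
      have h3 : ‖(d j : ℂ) * ∏ k, c (j k)‖ ^ 2 = d j ^ 2 * ∏ k, ‖c (j k)‖ ^ 2 := by
        rw [norm_mul, mul_pow, Complex.norm_real, Real.norm_eq_abs, sq_abs, norm_prod,
          Finset.prod_pow]
      have h4 := congrArg Complex.ofReal h3
      push_cast at h4
      exact h4
    exact_mod_cast h2
  rw [h1]
  have h3 : ∀ j : Bits n, Real.exp (lam * hammingWeight j) = ∏ k, if j k = 1 then Real.exp lam else 1 := by
    intro j
    rw [Finset.prod_ite, Finset.prod_const, Finset.prod_const_one, mul_one, mul_comm, Real.exp_nat_mul]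
    rfl
  have h4 : (‖c 0‖ ^ 2 + Real.exp lam * ‖c 1‖ ^ 2) ^ n
      = ∑ j : Bits n, Real.exp (lam * hammingWeight j) * ∏ k, ‖c (j k)‖ ^ 2 := by
    simp only [h3, ← Finset.prod_mul_distrib]
    rw [sum_bits_prod fun _ a => (if a = 1 then Real.exp lam else 1) * ‖c a‖ ^ 2]
    simp
  rw [h4, Finset.mul_sum, Finset.mul_sum]
  refine Finset.sum_le_sum fun j _ => ?_
  have hp : 0 ≤ ∏ k, ‖c (j k)‖ ^ 2 := by positivity
  rcases le_or_gt (hammingWeight j : ℝ) θ with h | h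
  · rw [hd0 j h]
    simp only [ne_eq, OfNat.ofNat_ne_zero, not_false_eq_true, zero_pow, zero_mul]
    positivity
  · have h5 : d j ^ 2 ≤ δ ^ 2 := sq_le_sq' (abs_le.1 (hd j h)).1 (abs_le.1 (hd j h)).2
    -- Exponential Markov inequality: the indicator of weight above `θ` is at most `exp (lam * (h -
    -- θ))`, whose mean factors over qubits.
    have h6 : 1 ≤ Real.exp (-(lam * θ)) * Real.exp (lam * hammingWeight j) := by
      rw [← Real.exp_add, Real.one_le_exp_iff]
      nlinarith
    calc _ ≤ δ ^ 2 * (1 * ∏ k, ‖c (j k)‖ ^ 2) := by rw [one_mul]; gcongr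
      _ ≤ δ ^ 2 * (Real.exp (-(lam * θ)) * Real.exp (lam * hammingWeight j) * ∏ k, ‖c (j k)‖ ^ 2) := by
        gcongr
      _ = _ := by ring

end Product

/-! ### Perturbed and unperturbed evolutions of `n` qubits -/

section Evolution

variable {n : ℕ}

lemma hadamard_conjTranspose : hadamard.conjTranspose = hadamard := by
  ext i j
  fin_cases i <;> fin_cases j <;> simp [hadamard]

lemma inv_sqrt_two_mul_self : ((√2 : ℝ) : ℂ)⁻¹ * ((√2 : ℝ) : ℂ)⁻¹ = 1 / 2 := by
  rw [← mul_inv, ← Complex.ofReal_mul, Real.mul_self_sqrt two_pos.le]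
  simp

lemma hadamard_mul_self : hadamard * hadamard = 1 := by
  have h := inv_sqrt_two_mul_self
  ext i j
  fin_cases i <;> fin_cases j <;> simp [hadamard, Matrix.mul_apply, Fin.sum_univ_two, h] <;>
    norm_num

lemma hadamard_mulVec_one (φ : Fin 2 → ℂ) :
    hadamard.mulVec φ 1 = ((√2 : ℝ) : ℂ)⁻¹ * (φ 0 - φ 1) := by
  simp [hadamard, Matrix.mulVec, dotProduct, Fin.sum_univ_two]
  ring

lemma hadamard_mulVec_zero (φ : Fin 2 → ℂ) :
    hadamard.mulVec φ 0 = ((√2 : ℝ) : ℂ)⁻¹ * (φ 0 + φ 1) := by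
  simp [hadamard, Matrix.mulVec, dotProduct, Fin.sum_univ_two]
  ring

lemma ketPlus_zero : (ketPlus 0 : Qubits n) =
    tensorPow n ![((1 / √2 : ℝ) : ℂ), ((1 / √2 : ℝ) : ℂ)] := by
  ext x
  change ∏ k, hadamard (x k) 0 = ∏ k, (![_, _] : Fin 2 → ℂ) (x k)
  refine Finset.prod_congr rfl fun k _ => ?_
  generalize x k = a
  fin_cases a <;> simp [hadamard]

lemma orthonormal_ketPlus : Orthonormal ℂ (ketPlus : Bits n → Qubits n) := by
  rw [ketPlus_eq]
  exact orthonormal_productBasis (by rw [hadamard_conjTranspose, hadamard_mul_self])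

lemma norm_ket (j : Bits n) : ‖ket j‖ = 1 := by simp [ket]

lemma isSymmetric_interpolate (E₀ E₁ : Bits n → ℝ) (s : ℝ) :
    (interpolate (initialHamiltonian E₀) (finalHamiltonian E₁) s :
      Qubits n →ₗ[ℂ] Qubits n).IsSymmetric := by
  intro v w
  have h0 := isSymmetric_spectralSum ketPlus E₀ v w
  have h1 := isSymmetric_spectralSum ket E₁ v w
  simp only [ContinuousLinearMap.coe_coe] at h0 h1
  simp only [ContinuousLinearMap.coe_coe, interpolate, initialHamiltonian, finalHamiltonian,
    add_apply, smul_apply, inner_add_left, inner_add_right, inner_smul_left, inner_smul_right, h0, h1,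
    Complex.conj_ofReal]

lemma exists_isAdiabaticEvolution (E₀ E₁ : Bits n → ℝ) {τ : ℝ} (hτ : 0 ≤ τ) :
    ∃ ψ : ℝ → Qubits n,
      IsAdiabaticEvolution (initialHamiltonian E₀) (finalHamiltonian E₁) τ (ketPlus 0) ψ := by
  refine exists_schrodinger (A := fun t => interpolate (initialHamiltonian E₀) (finalHamiltonian E₁)
    (t / τ)) (fun t => isSymmetric_interpolate E₀ E₁ _) ?_ hτ (orthonormal_ketPlus.1 0)
  unfold interpolate
  fun_prop

lemma norm_of_isAdiabaticEvolution {E₀ E₁ : Bits n → ℝ} {τ : ℝ} (hτ : 0 ≤ τ) {ψ : ℝ → Qubits n}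
    (hψ : IsAdiabaticEvolution (initialHamiltonian E₀) (finalHamiltonian E₁) τ (ketPlus 0) ψ) :
    ‖ψ τ‖ = 1 := by
  rw [norm_eq_of_hasDerivWithinAt (c := fun _ => 1) (fun t => isSymmetric_interpolate E₀ E₁ (t / τ))
    (by simpa using hψ.2) τ ⟨hτ, le_rfl⟩, hψ.1]
  exact orthonormal_ketPlus.1 0

/-- Tensor powers of solutions of the one-qubit equation solve the unperturbed equation. -/
lemma hasDerivWithinAt_tensorPow {τ : ℝ} {a b : ℝ → ℂ} {t : ℝ}
    (ha : HasDerivWithinAt a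
      (-Complex.I * (((1 - t / τ : ℝ) : ℂ) * ((a t - b t) / 2))) (Set.Icc 0 τ) t)
    (hb : HasDerivWithinAt b
      (-Complex.I * (((1 - t / τ : ℝ) : ℂ) * ((b t - a t) / 2) + ((t / τ : ℝ) : ℂ) * b t))
      (Set.Icc 0 τ) t) :
    HasDerivWithinAt (fun t => tensorPow n ![a t, b t])
      (-Complex.I • interpolate (initialHamiltonian fun j => (hammingWeight j : ℝ))
        (finalHamiltonian fun j => (hammingWeight j : ℝ)) (t / τ) (tensorPow n ![a t, b t]))
      (Set.Icc 0 τ) t := by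
  set φ : ℝ → Fin 2 → ℂ := fun t => ![a t, b t] with hφ
  have hcoord : ∀ c, HasDerivWithinAt (fun t => φ t c)
      (-Complex.I * (((1 - t / τ : ℝ) : ℂ) * (hadamard c 1 * hadamard.conjTranspose.mulVec (φ t) 1) +
        ((t / τ : ℝ) : ℂ) * ((1 : Matrix (Fin 2) (Fin 2) ℂ) c 1 *
          (1 : Matrix (Fin 2) (Fin 2) ℂ).conjTranspose.mulVec (φ t) 1))) (Set.Icc 0 τ) t := by
    have h01 : hadamard 0 1 = ((√2 : ℝ) : ℂ)⁻¹ := by simp [hadamard]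
    have h11 : hadamard 1 1 = -((√2 : ℝ) : ℂ)⁻¹ := by simp [hadamard]
    rw [hadamard_conjTranspose, hadamard_mulVec_one, Matrix.conjTranspose_one, Matrix.one_mulVec]
    refine Fin.forall_fin_two.2 ⟨ha.congr_deriv ?_, hb.congr_deriv ?_⟩
    · rw [h01, ← mul_assoc ((√2 : ℝ) : ℂ)⁻¹, inv_sqrt_two_mul_self,
        Matrix.one_apply_ne zero_ne_one]
      simp only [hφ, Matrix.cons_val_zero, Matrix.cons_val_one]
      ring
    · rw [h11, ← mul_assoc (-((√2 : ℝ) : ℂ)⁻¹), neg_mul (((√2 : ℝ) : ℂ)⁻¹), inv_sqrt_two_mul_self,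
        Matrix.one_apply_eq]
      simp only [hφ, Matrix.cons_val_zero, Matrix.cons_val_one]
      ring
  have hx : ∀ x : Bits n, HasDerivWithinAt (fun t => ∏ k, φ t (x k))
      ((-Complex.I • interpolate (initialHamiltonian fun j => (hammingWeight j : ℝ))
        (finalHamiltonian fun j => (hammingWeight j : ℝ)) (t / τ) (tensorPow n (φ t))) x)
      (Set.Icc 0 τ) t := by
    intro x
    have h := HasDerivWithinAt.fun_finsetProd (u := Finset.univ) fun k _ => hcoord (x k)
    refine h.congr_deriv ?_
    simp only [interpolate, initialHamiltonian, finalHamiltonian, ketPlus_eq, ket_eq,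
      add_apply, smul_apply, PiLp.add_apply, PiLp.smul_apply]
    rw [spectralSum_hammingWeight_tensorPow (by rw [hadamard_conjTranspose, hadamard_mul_self]),
      spectralSum_hammingWeight_tensorPow (by simp)]
    simp only [smul_eq_mul, Finset.mul_sum, ← Finset.sum_add_distrib]
    exact Finset.sum_congr rfl fun k _ => by ring
  exact (PiLp.continuousLinearEquiv 2 ℝ fun _ : Bits n => ℂ).symm.hasFDerivAt.comp_hasDerivWithinAt t
    (hasDerivWithinAt_pi.2 hx)

/-- The Bernoulli moment generating function `1 + p (exp lam - 1)` increases with `p`. -/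
lemma exp_moment_le {p q δ lam : ℝ} (hlam : 0 ≤ lam) (hpq : q + p = 1) (hp : p ≤ 1 / 2 + δ) :
    q + Real.exp lam * p ≤ 1 + (1 / 2 + δ) * (Real.exp lam - 1) := by
  have h : 0 ≤ Real.exp lam - 1 := by linarith [Real.one_le_exp hlam]
  nlinarith [mul_le_mul_of_nonneg_right hp h]

/-- Robustness of the adiabatic evolution for a fixed number of qubits. -/
theorem exists_phase_norm_sub_le {ε τ lam : ℝ} (hτ : 21 ≤ τ) (hlam : 0 ≤ lam) (hε : 0 ≤ ε)
    {E₀ E₁ : Bits n → ℝ} (hE₀ : IsPerturbedSpectrum ε E₀) (hE₁ : IsPerturbedSpectrum ε E₁)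
    {ψ : ℝ → Qubits n}
    (hψ : IsAdiabaticEvolution (initialHamiltonian E₀) (finalHamiltonian E₁) τ (ketPlus 0) ψ) :
    ∃ γ : ℂ, ‖γ‖ = 1 ∧ ‖ψ τ - γ • ket 0‖ ≤
      √(2 * (ε * √(Real.exp (-(lam * thetaH n)) *
        (1 + (1 / 2 + √(21 / τ)) * (Real.exp lam - 1)) ^ n) * τ)) + √(n * (21 / τ)) := by
  have hτ0 : 0 ≤ τ := by linarith
  obtain ⟨a, b, ha0, hb0, ha, hb, hab, haτ⟩ := exists_adiabatic_qubit hτ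
  set Q := Real.exp (-(lam * thetaH n)) *
    (1 + (1 / 2 + √(21 / τ)) * (Real.exp lam - 1)) ^ n with hQ
  set χ : ℝ → Qubits n := fun t => tensorPow n ![a t, b t] with hχ
  have hχ1 : ∀ t ∈ Set.Icc 0 τ, ‖χ t‖ = 1 := fun t ht => by
    have h := norm_tensorPow_sq (n := n) ![a t, b t]
    simp only [Matrix.cons_val_zero, Matrix.cons_val_one, (hab t ht).1, one_pow] at h
    exact (sq_eq_sq₀ (norm_nonneg _) zero_le_one).1 (by rw [one_pow]; exact h)
  have hχ0 : χ 0 = ketPlus 0 := by simp only [hχ, ha0, hb0, ketPlus_zero]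
  have hbound : ∀ (U : Matrix (Fin 2) (Fin 2) ℂ) (φ : Fin 2 → ℂ) (E : Bits n → ℝ),
      U.conjTranspose * U = 1 → IsPerturbedSpectrum ε E →
      ‖U.conjTranspose.mulVec φ 0‖ ^ 2 + ‖U.conjTranspose.mulVec φ 1‖ ^ 2 = 1 →
      ‖U.conjTranspose.mulVec φ 1‖ ^ 2 ≤ 1 / 2 + √(21 / τ) →
      ‖spectralSum (productBasis U) E (tensorPow n φ) -
        spectralSum (productBasis U) (fun j => (hammingWeight j : ℝ)) (tensorPow n φ)‖ ≤ ε * √Q := by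
    intro U φ E hU hE h1 h2
    rw [← sub_apply, spectralSum_sub]
    refine abs_le_of_sq_le_sq' ?_ (by positivity) |>.2
    refine (norm_spectralSum_tensorPow_sq_le hU φ hlam (θ := thetaH n) (δ := ε)
      (fun j hj => by simp [hE.1 j hj]) (fun j hj => hE.2 j hj)).trans ?_
    have h3 : 0 ≤ Real.exp lam - 1 := by linarith [Real.one_le_exp hlam]
    rw [mul_pow, Real.sq_sqrt (by positivity), hQ]
    have h4 := pow_le_pow_left₀ (by positivity) (exp_moment_le hlam h1 h2) n
    gcongr
  have hC : ∀ t ∈ Set.Icc 0 τ,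
      ‖interpolate (initialHamiltonian E₀) (finalHamiltonian E₁) (t / τ) (χ t) -
        interpolate (initialHamiltonian fun j => (hammingWeight j : ℝ))
          (finalHamiltonian fun j => (hammingWeight j : ℝ)) (t / τ) (χ t)‖ ≤ ε * √Q := by
    intro t ht
    have hs0 : 0 ≤ t / τ := div_nonneg ht.1 hτ0
    have hs1 : t / τ ≤ 1 := div_le_one_of_le₀ ht.2 hτ0
    have hs2 : ‖((√2 : ℝ) : ℂ)⁻¹‖ ^ 2 = 1 / 2 := by
      rw [← norm_pow, sq, inv_sqrt_two_mul_self]; simp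
    have h0 := hbound hadamard ![a t, b t] E₀ (by rw [hadamard_conjTranspose, hadamard_mul_self]) hE₀
      (by
        rw [hadamard_conjTranspose, hadamard_mulVec_one, hadamard_mulVec_zero, norm_mul, norm_mul,
          mul_pow, mul_pow, hs2]
        have h := parallelogram_law_with_norm ℂ (a t) (b t)
        simp only [Matrix.cons_val_zero, Matrix.cons_val_one]
        nlinarith [(hab t ht).1])
      (by
        rw [hadamard_conjTranspose, hadamard_mulVec_one, norm_mul, mul_pow, hs2]
        simp only [Matrix.cons_val_zero, Matrix.cons_val_one]
        linarith [(hab t ht).2.2])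
    have h1 := hbound 1 ![a t, b t] E₁ (by simp) hE₁ (by simpa using (hab t ht).1)
      (by simpa using (hab t ht).2.1)
    simp only [interpolate, initialHamiltonian, finalHamiltonian, ketPlus_eq, ket_eq,
      add_apply, smul_apply]
    rw [add_sub_add_comm, ← smul_sub, ← smul_sub]
    refine (norm_add_le _ _).trans ?_
    rw [norm_smul, norm_smul, Complex.norm_real, Complex.norm_real,
      Real.norm_of_nonneg (sub_nonneg.2 hs1), Real.norm_of_nonneg hs0]
    calc _ ≤ (1 - t / τ) * (ε * √Q) + t / τ * (ε * √Q) :=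
          add_le_add (mul_le_mul_of_nonneg_left h0 (sub_nonneg.2 hs1))
            (mul_le_mul_of_nonneg_left h1 hs0)
      _ = _ := by ring
  have hmem : τ ∈ Set.Icc 0 τ := ⟨hτ0, le_rfl⟩
  have h1 := norm_inner_sub_one_le
    (A := fun t => interpolate (initialHamiltonian E₀) (finalHamiltonian E₁) (t / τ))
    (fun t => isSymmetric_interpolate E₀ E₁ _) hτ0 (hψ.1.trans hχ0.symm)
    (by rw [hψ.1]; exact orthonormal_ketPlus.1 0) hψ.2
    (fun t ht => hasDerivWithinAt_tensorPow (ha t ht) (hb t ht)) hC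
  have h2 := Real.le_sqrt_of_sq_le
    (norm_sub_sq_le (norm_of_isAdiabaticEvolution hτ0 hψ) (hχ1 τ hmem) h1)
  -- The overlap of the product state with the target is `a τ ^ n`; since `‖a τ‖ ≥ ‖a τ‖ ^ 2 ≥ 1 -
  -- 21 / (2 τ)`, Bernoulli's inequality gives a loss of at most `n` times the one-qubit loss.
  obtain ⟨γ, hγ, h3⟩ := exists_phase (hχ1 τ hmem) (norm_ket (0 : Bits n)) (c := n * (21 / τ / 2)) (by
    have h4 : (inner ℂ (ket 0) (χ τ) : ℂ) = a τ ^ n := by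
      rw [ket_eq, hχ, inner_productBasis_tensorPow]
      simp
    have h5 : ‖a τ‖ ^ 2 ≤ 1 := by nlinarith [(hab τ hmem).1, sq_nonneg ‖b τ‖]
    have h6 : ‖a τ‖ ^ 2 ≤ ‖a τ‖ := by
      nlinarith [norm_nonneg (a τ), (sq_le_one_iff₀ (norm_nonneg _)).1 h5]
    have h7 : 21 / τ ≤ 1 := div_le_one_of_le₀ hτ hτ0
    rw [h4, norm_pow]
    calc 1 - n * (21 / τ / 2) = 1 + n * (-(21 / τ / 2)) := by ring
      _ ≤ (1 + -(21 / τ / 2)) ^ n := one_add_mul_le_pow (by linarith) n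
      _ ≤ ‖a τ‖ ^ n := pow_le_pow_left₀ (by linarith) (by linarith) n)
  refine ⟨γ, hγ, (norm_sub_le_norm_sub_add_norm_sub _ (χ τ) _).trans (add_le_add h2 ?_)⟩
  exact Real.le_sqrt_of_sq_le (h3.trans (by linarith))

end Evolution

/-! ### Chernoff exponent and rates for `τ = n ^ 4` -/

section Asymptotics

/-- Chernoff estimate at the threshold `θ_h` for a slightly biased binomial distribution. -/
lemma chernoff_thetaH_le {n : ℕ} (hn : 0 < n) {δ : ℝ} (hδ : 0 ≤ δ) (hδn : 2 * n * δ ≤ 1)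
    (hlog : 16 * Real.log n ≤ n) :
    Real.exp (-(4 * √(Real.log n / n) * thetaH n)) *
      (1 + (1 / 2 + δ) * (Real.exp (4 * √(Real.log n / n)) - 1)) ^ n ≤ (2 / (n : ℝ) ^ 11) ^ 2 := by
  have hn0 : (0 : ℝ) < n := by exact_mod_cast hn
  have hL : 0 ≤ Real.log n := Real.log_natCast_nonneg n
  set L := Real.log n with hLdef
  set lam := 4 * √(L / n) with hlam
  have hlam0 : 0 ≤ lam := by positivity
  -- The exponent is `-lam √(40 n L) + n lam² / 8 + 2 n δ ≤ -24 L + 2 L + 1`. This `lam` is not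
  -- optimal, but `n ^ (-22)` suffices.
  have hlam2 : n * lam ^ 2 = 16 * L := by
    rw [hlam, mul_pow, Real.sq_sqrt (by positivity)]; field_simp; ring
  have hlam1 : lam ≤ 1 := by
    rw [← sq_le_one_iff₀ hlam0]
    exact le_of_mul_le_mul_left (by rw [hlam2, mul_one]; exact hlog) hn0
  have h1 : 1 + (1 / 2 + δ) * (Real.exp lam - 1) ≤ Real.exp (lam / 2 + lam ^ 2 / 8 + 2 * δ) := by
    -- Hoeffding's bound for a fair bit, through `cosh u ≤ exp (u² / 2)`; the bias `δ` then costs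
    -- only a factor `exp (2 δ)` because `lam ≤ 1`.
    have h2 : (1 + Real.exp lam) / 2 ≤ Real.exp (lam / 2 + lam ^ 2 / 8) := by
      have h3 : (1 + Real.exp lam) / 2 = Real.exp (lam / 2) * Real.cosh (lam / 2) := by
        rw [Real.cosh_eq, mul_div_assoc', mul_add, ← Real.exp_add, ← Real.exp_add]
        simp only [add_halves, add_neg_cancel, Real.exp_zero]
        ring
      rw [h3, Real.exp_add]
      refine mul_le_mul_of_nonneg_left ((Real.cosh_le_exp_half_sq _).trans_eq ?_) (Real.exp_nonneg _)
      congr 1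
      ring
    have h4 : Real.exp lam ≤ 3 := (Real.exp_le_exp.2 hlam1).trans Real.exp_one_lt_three.le
    have h5 : 1 ≤ Real.exp (lam / 2 + lam ^ 2 / 8) := Real.one_le_exp (by positivity)
    have h6 : 1 + 2 * δ ≤ Real.exp (2 * δ) := by linarith [Real.add_one_le_exp (2 * δ)]
    calc _ = (1 + Real.exp lam) / 2 + δ * (Real.exp lam - 1) := by ring
      _ ≤ Real.exp (lam / 2 + lam ^ 2 / 8) + δ * (2 * Real.exp (lam / 2 + lam ^ 2 / 8)) := by
        gcongr
        linarith
      _ = Real.exp (lam / 2 + lam ^ 2 / 8) * (1 + 2 * δ) := by ring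
      _ ≤ Real.exp (lam / 2 + lam ^ 2 / 8) * Real.exp (2 * δ) := by gcongr
      _ = _ := by rw [← Real.exp_add]
  have h7 : 0 ≤ 1 + (1 / 2 + δ) * (Real.exp lam - 1) := by
    have : 0 ≤ Real.exp lam - 1 := by linarith [Real.one_le_exp hlam0]
    positivity
  have h8 : 24 * L ≤ lam * √(40 * n * L) := by
    have h9 : lam * √(40 * n * L) = 4 * (√40 * L) := by
      rw [hlam, mul_assoc, ← Real.sqrt_mul (by positivity)]
      congr 1
      rw [show L / n * (40 * n * L) = 40 * L ^ 2 by field_simp, Real.sqrt_mul (by norm_num),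
        Real.sqrt_sq hL]
    have h10 : (6 : ℝ) ≤ √40 := Real.le_sqrt_of_sq_le (by norm_num)
    rw [h9]
    nlinarith [mul_le_mul_of_nonneg_right h10 hL]
  calc _ ≤ Real.exp (-(lam * thetaH n)) * Real.exp (lam / 2 + lam ^ 2 / 8 + 2 * δ) ^ n := by gcongr
    _ = Real.exp (-(lam * thetaH n) + n * (lam / 2 + lam ^ 2 / 8 + 2 * δ)) := by
      rw [← Real.exp_nat_mul, ← Real.exp_add]
    _ ≤ Real.exp (1 - (22 : ℕ) * L) := by
      rw [Real.exp_le_exp, thetaH, ← hLdef]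
      push_cast
      nlinarith
    _ = Real.exp 1 / n ^ 22 := by
      rw [Real.exp_sub, Real.exp_nat_mul, hLdef, Real.exp_log hn0]
    _ ≤ 4 / n ^ 22 := by
      gcongr
      linarith [Real.exp_one_lt_three]
    _ = _ := by ring

/-- Quantitative form of the robustness for annealing time `n ^ 4`. -/
lemma exists_phase_norm_sub_le_div {n : ℕ} (hn : 10 ≤ n) (hlog : 16 * Real.log n ≤ n)
    {ε : ℝ} (hε0 : 0 ≤ ε) (hε : ε ≤ (n : ℝ) ^ 5) {E₀ E₁ : Bits n → ℝ}
    (hE₀ : IsPerturbedSpectrum ε E₀) (hE₁ : IsPerturbedSpectrum ε E₁) {ψ : ℝ → Qubits n}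
    (hψ : IsAdiabaticEvolution (initialHamiltonian E₀) (finalHamiltonian E₁) ((n : ℝ) ^ 4)
      (ketPlus 0) ψ) :
    ∃ γ : ℂ, ‖γ‖ = 1 ∧ ‖ψ ((n : ℝ) ^ 4) - γ • ket 0‖ ≤ 7 / n := by
  have hn' : (10 : ℝ) ≤ n := by exact_mod_cast hn
  have hn0 : (0 : ℝ) < n := by linarith
  have hτ : (21 : ℝ) ≤ (n : ℝ) ^ 4 :=
    le_trans (by norm_num) (pow_le_pow_left₀ (by norm_num) hn' 4)
  obtain ⟨γ, hγ, h⟩ := exists_phase_norm_sub_le (lam := 4 * √(Real.log n / n)) hτ (by positivity)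
    hε0 hE₀ hE₁ hψ
  refine ⟨γ, hγ, h.trans ?_⟩
  have hδ : √(21 / (n : ℝ) ^ 4) ≤ 5 / n ^ 2 := by
    refine Real.sqrt_le_iff.2 ⟨by positivity, ?_⟩
    rw [div_pow, ← pow_mul]
    gcongr
    norm_num
  have hδn : 2 * n * √(21 / (n : ℝ) ^ 4) ≤ 1 := by
    calc 2 * n * √(21 / (n : ℝ) ^ 4) ≤ 2 * n * (5 / n ^ 2) := by gcongr
      _ = 10 / n := by field_simp; norm_num
      _ ≤ 1 := (div_le_one hn0).2 hn'
  have hQ := Real.sqrt_le_iff.2 ⟨by positivity,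
    chernoff_thetaH_le (by omega) (Real.sqrt_nonneg _) hδn hlog⟩
  have h1 : √(2 * (ε * √(Real.exp (-(4 * √(Real.log n / n) * thetaH n)) *
      (1 + (1 / 2 + √(21 / (n : ℝ) ^ 4)) * (Real.exp (4 * √(Real.log n / n)) - 1)) ^ n) *
        (n : ℝ) ^ 4)) ≤ 2 / n := by
    refine Real.sqrt_le_iff.2 ⟨by positivity, ?_⟩
    -- The exponents balance as `5 - 11 + 4 = -2`: energy change, square root of the tail mass,
    -- annealing time.
    calc _ ≤ 2 * ((n : ℝ) ^ 5 * (2 / (n : ℝ) ^ 11) * (n : ℝ) ^ 4) := by gcongr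
      _ = (2 / n) ^ 2 := by field_simp
  have h2 : √(n * (21 / (n : ℝ) ^ 4)) ≤ 5 / n := by
    refine Real.sqrt_le_iff.2 ⟨by positivity, ?_⟩
    rw [div_pow, mul_div_assoc', div_le_div_iff₀ (by positivity) (by positivity)]
    have h3 : (n : ℝ) ^ 3 ≤ n ^ 4 := pow_le_pow_right₀ (by linarith) (by norm_num)
    nlinarith
  calc _ ≤ 2 / (n : ℝ) + 5 / n := add_le_add h1 h2
    _ = 7 / n := by ring

end Asymptotics

end AdiabaticRobustness

/-! ### The asymptotic statement -/

theorem corollary1 (ε : ℕ → ℝ) (hε : ε =o[atTop] fun n : ℕ => (n : ℝ) ^ 5) :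
    ∃ η : ℕ → ℝ, Tendsto η atTop (𝓝 0) ∧
      ∀ (n : ℕ) (E₀ E₁ : AdiabaticRobustness.Bits n → ℝ),
        AdiabaticRobustness.IsPerturbedSpectrum (ε n) E₀ →
        AdiabaticRobustness.IsPerturbedSpectrum (ε n) E₁ →
        (∃ ψ : ℝ → AdiabaticRobustness.Qubits n,
          AdiabaticRobustness.IsAdiabaticEvolution
            (AdiabaticRobustness.initialHamiltonian E₀) (AdiabaticRobustness.finalHamiltonian E₁)
            ((n : ℝ) ^ 4) (AdiabaticRobustness.ketPlus 0) ψ) ∧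
        ∀ ψ : ℝ → AdiabaticRobustness.Qubits n,
          AdiabaticRobustness.IsAdiabaticEvolution
            (AdiabaticRobustness.initialHamiltonian E₀) (AdiabaticRobustness.finalHamiltonian E₁)
            ((n : ℝ) ^ 4) (AdiabaticRobustness.ketPlus 0) ψ →
          ∃ γ : ℂ, ‖γ‖ = 1 ∧
            ‖ψ ((n : ℝ) ^ 4) - γ • AdiabaticRobustness.ket 0‖ ≤ η n := by
  -- The growth condition enters only as `|ε n| ≤ n ^ 5` eventually: the rate `7 / n` is universal
  -- and `ε` merely fixes where it starts.
  have hev : ∀ᶠ n : ℕ in atTop, 10 ≤ n ∧ 16 * Real.log n ≤ n ∧ |ε n| ≤ (n : ℝ) ^ 5 := by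
    have h1 : ∀ᶠ n : ℕ in atTop, 16 * Real.log n ≤ n := by
      have h := tendsto_natCast_atTop_atTop.eventually
        (Real.isLittleO_log_id_atTop.bound (by norm_num : (0 : ℝ) < 1 / 16))
      filter_upwards [h] with n hn
      rw [Real.norm_of_nonneg (Real.log_natCast_nonneg n), id, Real.norm_natCast] at hn
      linarith
    filter_upwards [eventually_ge_atTop 10, h1, hε.bound one_pos] with n h10 hlog hn
    refine ⟨h10, hlog, ?_⟩
    simpa [abs_of_nonneg] using hn
  obtain ⟨N, hN⟩ := eventually_atTop.1 hev
  -- Before `N`, the value `2` is the trivial bound between unit vectors.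
  refine ⟨fun n => if N ≤ n then 7 / (n : ℝ) else 2, ?_, fun n E₀ E₁ hE₀ hE₁ =>
    ⟨AdiabaticRobustness.exists_isAdiabaticEvolution E₀ E₁ (by positivity), fun ψ hψ => ?_⟩⟩
  · refine (tendsto_const_div_atTop_nhds_zero_nat 7).congr' ?_
    filter_upwards [eventually_ge_atTop N] with n hn
    rw [if_pos hn]
  · by_cases h : N ≤ n
    · simp only [if_pos h]
      obtain ⟨h10, hlog, hb⟩ := hN n h
      have habs : ∀ E : AdiabaticRobustness.Bits n → ℝ,
          AdiabaticRobustness.IsPerturbedSpectrum (ε n) E →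
          AdiabaticRobustness.IsPerturbedSpectrum |ε n| E := fun E hE =>
        ⟨hE.1, fun j hj => (hE.2 j hj).trans (le_abs_self _)⟩
      exact AdiabaticRobustness.exists_phase_norm_sub_le_div h10 hlog (abs_nonneg _) hb
        (habs E₀ hE₀) (habs E₁ hE₁) hψ
    · simp only [if_neg h]
      refine ⟨1, norm_one, (norm_sub_le _ _).trans ?_⟩
      rw [AdiabaticRobustness.norm_of_isAdiabaticEvolution (by positivity) hψ, norm_smul, norm_one,
        AdiabaticRobustness.norm_ket]
      norm_num
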